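/- For a nonempty set $V\subseteq\mathbb{C}^{n}$ (with the Euclidean norm) and $\rho>0$, let $N_V(\rho)$ be the least $k\in\mathbb{N}$ such that $V$ is covered by $k$ open balls of radius $\rho$ centered at points of $V$ (with $N_V(\rho)=\infty$ if there is no such $k$), let $$\underline{\dim}_{\mathrm B}(V)=\liminf_{\rho\to 0^+}\frac{\log N_V(\rho)}{\log(1/\rho)},$$ and, for nonempty $U\subseteq\mathbb{C}^{n}$, let the lower modified Minkowski dimension of $U$ be $$\underline{\dim}_{\mathrm{MB}}(U)=\inf\Big\{\sup_{i\in\mathbb{N}}\underline{\dim}_{\mathrm B}(U_i): U\subseteq\bigcup_{i\in\mathbb{N}}U_i\Big\},$$ where the infimum is over all coverings $\{U_i\}_{i\in\mathbb{N}}$ of $U$ by nonempty compact sets $U_i\subseteq\mathbb{C}^n$. **Theorem.** Let $U\subseteq\mathbb{C}^{p+q}$ be nonempty with $\underline{\dim}_{\mathrm{MB}}(U)<2m$, and let $B\in\mathbb{C}^{m\times q}$, with $m\ge q$, be a full-rank matrix. Then $$\ker[A\ \ B]\cap(U\setminus\{0\})=\emptyset$$ for Lebesgue-almost all $A\in\mathbb{C}^{m\times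 p}$, where $[A\ \ B]\in\mathbb{C}^{m\times(p+q)}$ is the matrix whose columns are those of $A$ followed by those of $B$. -/

import Mathlib

open MeasureTheory Filter Topology

noncomputable section

/-- The covering number of `U` for radius `ρ`: the least `k` such that `U` is covered by `k` open
balls of radius `ρ` centered at points of `U` (and `∞` if there is no such `k`). -/
def ballCoveringNumber {E : Type*} [PseudoMetricSpace E] (U : Set E) (ρ : ℝ) : ℕ∞ :=
  sInf {n : ℕ∞ | ∃ k : ℕ, n = k ∧
    ∃ u : Fin k → E, (∀ i, u i ∈ U) ∧ U ⊆ ⋃ i, Metric.ball (u i) ρ}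

/-- The lower Minkowski (box-counting) dimension
`liminf_{ρ → 0, ρ > 0} log N_U(ρ) / log (1 / ρ)`, an extended real number. -/
def lowerMinkowskiDim {E : Type*} [PseudoMetricSpace E] (U : Set E) : EReal :=
  liminf (fun ρ : ℝ => ENNReal.log (ballCoveringNumber U ρ : ENNReal) /
    ((Real.log (1 / ρ) : ℝ) : EReal)) (𝓝[>] (0 : ℝ))

/-- The lower modified Minkowski dimension: the infimum of `sup_i lowerMinkowskiDim (V i)` over all
countable coverings of `U` by nonempty compact sets `V i`. -/
def lowerModifiedMinkowskiDim {E : Type*} [PseudoMetricSpace E] (U : Set E) : EReal :=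
  sInf {d : EReal | ∃ V : ℕ → Set E, (∀ i, (V i).Nonempty ∧ IsCompact (V i)) ∧
    U ⊆ ⋃ i, V i ∧ d = ⨆ i, lowerMinkowskiDim (V i)}

/-- The block matrix `[A B]` with the columns of `A` followed by those of `B`. -/
def Matrix.hconcat {m p q : ℕ} (A : Matrix (Fin m) (Fin p) ℂ) (B : Matrix (Fin m) (Fin q) ℂ) :
    Matrix (Fin m) (Fin (p + q)) ℂ :=
  Matrix.of fun i => Fin.append (A i) (B i)

end

/-!
If `K` has lower box-counting dimension less than `d`, then along a sequence of radii `ρ → 0` it is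
covered by `o(ρ ^ (-d))` balls of radius `ρ`. Let `Ψ x : E → F` be linear surjections and let
`β x : F`, both Lipschitz in `x ∈ K`. When `a` ranges over a bounded set, a zero of
`x ↦ Ψ x a + β x` in a ball of radius `ρ` forces `‖Ψ x₀ a + β x₀‖ = O(ρ)` at any chosen point `x₀`
of that ball. With `d = dim F` this confines `a` to a set of measure `O(ρ ^ d)`, uniformly as long
as `Ψ x₀` has a right inverse of bounded norm. Summing over the cover shows that the bad parameters
form a null set; right inverses of all norms are reached by countable exhaustion.

For `[A B]` write `x = (y, z)`. The map `A ↦ A y` is onto `ℂ ^ m`, of real dimension `2 * m`,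
as soon as `y ≠ 0`, while for `y = 0` the kernel equation reads `B z = 0`, which
forces `z = 0` when `B` is injective.
-/

open Metric Module Matrix
open scoped ENNReal NNReal Pointwise

section Covering

variable {X : Type*} [PseudoMetricSpace X] {K U : Set X}

lemma exists_cover_card_eq_ballCoveringNumber {ρ : ℝ} (h : ballCoveringNumber K ρ ≠ ⊤) :
    ∃ (k : ℕ) (u : Fin k → X), ballCoveringNumber K ρ = k ∧ K ⊆ ⋃ i, ball (u i) ρ := by
  have hne : {n : ℕ∞ | ∃ k : ℕ, n = k ∧
      ∃ u : Fin k → X, (∀ i, u i ∈ K) ∧ K ⊆ ⋃ i, ball (u i) ρ}.Nonempty := by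
    by_contra hempty
    exact h (by rw [ballCoveringNumber, Set.not_nonempty_iff_eq_empty.1 hempty, sInf_empty])
  obtain ⟨k, hk, u, -, hcover⟩ := csInf_mem hne
  exact ⟨k, u, hk, hcover⟩

lemma frequently_ballCoveringNumber_le_rpow_neg {s : ℝ} (hK : lowerMinkowskiDim K < s) :
    ∃ᶠ ρ : ℝ in 𝓝[>] 0, (ballCoveringNumber K ρ : ℝ≥0∞) ≤ ENNReal.ofReal (ρ ^ (-s)) := by
  have hsmall : ∀ᶠ ρ : ℝ in 𝓝[>] 0, ρ ∈ Set.Ioo (0 : ℝ) 1 := Ioo_mem_nhdsGT one_pos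
  refine ((frequently_lt_of_liminf_lt (by isBoundedDefault) hK).and_eventually hsmall).mono ?_
  rintro ρ ⟨hρ, hρ0, hρ1⟩
  have hlog : 0 < Real.log (1 / ρ) := Real.log_pos (one_lt_one_div hρ0 hρ1)
  rw [EReal.div_lt_iff (by exact_mod_cast hlog) (EReal.coe_ne_top _)] at hρ
  rw [← ENNReal.log_le_log_iff, ENNReal.log_ofReal_of_pos (Real.rpow_pos_of_pos hρ0 _),
    Real.log_rpow hρ0]
  convert hρ.le using 1
  rw [one_div, Real.log_inv, ← EReal.coe_mul, neg_mul_comm]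

lemma eq_zero_of_forall_cover_le {d : ℝ} {t C : ℝ≥0∞} (hC : C ≠ ∞)
    (hK : lowerMinkowskiDim K < d)
    (h : ∀ ρ : ℝ, 0 < ρ → ∀ (k : ℕ) (u : Fin k → X), K ⊆ ⋃ i, ball (u i) ρ →
      t ≤ k * (C * ENNReal.ofReal ρ ^ d)) :
    t = 0 := by
  obtain ⟨s, hKs, hsd⟩ := EReal.lt_iff_exists_real_btwn.1 hK
  have hds : 0 < d - s := sub_pos.2 (by exact_mod_cast hsd)
  have hlim : Tendsto (fun ρ : ℝ => C * ENNReal.ofReal ρ ^ (d - s)) (𝓝[>] 0) (𝓝 0) := by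
    have hcont : Continuous fun ρ : ℝ => C * ENNReal.ofReal ρ ^ (d - s) :=
      (ENNReal.continuous_const_mul hC).comp
        (ENNReal.continuous_rpow_const.comp ENNReal.continuous_ofReal)
    simpa [ENNReal.zero_rpow_of_pos hds] using (hcont.tendsto 0).mono_left nhdsWithin_le_nhds
  refine le_antisymm (ge_of_tendsto_of_frequently hlim ?_) zero_le
  refine ((frequently_ballCoveringNumber_le_rpow_neg hKs).and_eventually
    self_mem_nhdsWithin).mono ?_
  rintro ρ ⟨hN, hρ : 0 < ρ⟩
  have hfinite : ballCoveringNumber K ρ ≠ ⊤ := by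
    intro htop
    simp [htop] at hN
  obtain ⟨k, u, hk, hcover⟩ := exists_cover_card_eq_ballCoveringNumber hfinite
  rw [hk, ENat.toENNReal_coe, ← ENNReal.ofReal_rpow_of_pos hρ] at hN
  calc t ≤ k * (C * ENNReal.ofReal ρ ^ d) := h ρ hρ k u hcover
    _ ≤ ENNReal.ofReal ρ ^ (-s) * (C * ENNReal.ofReal ρ ^ d) := by gcongr
    _ = C * ENNReal.ofReal ρ ^ (d - s) := by
        rw [mul_left_comm, ← ENNReal.rpow_add _ _ (by simpa using hρ) ENNReal.ofReal_ne_top,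
          neg_add_eq_sub]

lemma exists_countable_cover_lowerMinkowskiDim_lt {d : EReal}
    (hU : lowerModifiedMinkowskiDim U < d) :
    ∃ V : ℕ → Set X, U ⊆ ⋃ i, V i ∧ ∀ i, lowerMinkowskiDim (V i) < d := by
  obtain ⟨_, ⟨V, -, hUV, rfl⟩, hlt⟩ := sInf_lt_iff.1 hU
  exact ⟨V, hUV, fun i => (le_iSup _ i).trans_lt hlt⟩

end Covering

section SmallBall

variable {X Y Ω : Type*} [PseudoMetricSpace X] [PseudoMetricSpace Y] [MeasurableSpace Ω]
  {μ : Measure Ω} {Φ : Ω → X → Y} {S : Set X} {T : Set Ω} {y : Y} {L : ℝ≥0} {C : ℝ≥0∞} {d : ℝ}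

lemma measure_exists_mem_ball_eq_le
    (hLip : ∀ ω ∈ T, LipschitzOnWith L (Φ ω) S)
    (hsmall : ∀ x ∈ S, ∀ δ : ℝ, 0 ≤ δ →
      μ {ω ∈ T | dist (Φ ω x) y ≤ δ} ≤ C * ENNReal.ofReal δ ^ d)
    {ρ : ℝ} (hρ : 0 ≤ ρ) (u : X) :
    μ {ω ∈ T | ∃ x ∈ S ∩ ball u ρ, Φ ω x = y} ≤ C * ENNReal.ofReal (L * (2 * ρ)) ^ d := by
  obtain hempty | ⟨x₀, hx₀S, hx₀u⟩ := (S ∩ ball u ρ).eq_empty_or_nonempty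
  · simp [hempty]
  refine (measure_mono ?_).trans (hsmall x₀ hx₀S (L * (2 * ρ)) (by positivity))
  rintro ω ⟨hωT, x, ⟨hxS, hxu⟩, rfl⟩
  have hdist : dist x₀ x ≤ 2 * ρ := by
    linarith [dist_triangle_right x₀ x u, mem_ball.1 hxu, mem_ball.1 hx₀u]
  exact ⟨hωT, ((hLip ω hωT).dist_le_mul x₀ hx₀S x hxS).trans (by gcongr)⟩

lemma measure_exists_mem_eq_eq_zero_of_lowerMinkowskiDim_lt {K : Set X} (hd : 0 ≤ d) (hC : C ≠ ∞)
    (hK : lowerMinkowskiDim K < d) (hSK : S ⊆ K)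
    (hLip : ∀ ω ∈ T, LipschitzOnWith L (Φ ω) S)
    (hsmall : ∀ x ∈ S, ∀ δ : ℝ, 0 ≤ δ →
      μ {ω ∈ T | dist (Φ ω x) y ≤ δ} ≤ C * ENNReal.ofReal δ ^ d) :
    μ {ω ∈ T | ∃ x ∈ S, Φ ω x = y} = 0 := by
  refine eq_zero_of_forall_cover_le (C := C * ENNReal.ofReal (L * 2) ^ d)
    (ENNReal.mul_ne_top hC (ENNReal.rpow_ne_top_of_nonneg hd ENNReal.ofReal_ne_top)) hK
    fun ρ hρ k u hcover => ?_
  have hsub : {ω ∈ T | ∃ x ∈ S, Φ ω x = y} ⊆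
      ⋃ i, {ω ∈ T | ∃ x ∈ S ∩ ball (u i) ρ, Φ ω x = y} := by
    rintro ω ⟨hωT, x, hxS, hx⟩
    obtain ⟨i, hi⟩ := Set.mem_iUnion.1 (hcover (hSK hxS))
    exact Set.mem_iUnion.2 ⟨i, hωT, x, ⟨hxS, hi⟩, hx⟩
  calc μ {ω ∈ T | ∃ x ∈ S, Φ ω x = y}
      ≤ ∑ i, μ {ω ∈ T | ∃ x ∈ S ∩ ball (u i) ρ, Φ ω x = y} :=
        (measure_mono hsub).trans (measure_iUnion_fintype_le _ _)
    _ ≤ ∑ _i : Fin k, C * ENNReal.ofReal (L * (2 * ρ)) ^ d :=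
        Finset.sum_le_sum fun i _ => measure_exists_mem_ball_eq_le hLip hsmall hρ.le (u i)
    _ = k * (C * ENNReal.ofReal (L * 2) ^ d * ENNReal.ofReal ρ ^ d) := by
        rw [Finset.sum_const, Finset.card_univ, Fintype.card_fin, nsmul_eq_mul,
          ← mul_assoc (L : ℝ), ENNReal.ofReal_mul (by positivity),
          ENNReal.mul_rpow_of_nonneg _ _ hd, mul_assoc C]

lemma measure_exists_mem_eq_eq_zero_of_lowerModifiedMinkowskiDim_lt {U : Set X} (hd : 0 ≤ d)
    (hC : C ≠ ∞) (hU : lowerModifiedMinkowskiDim U < d) (hSU : S ⊆ U)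
    (hLip : ∀ ω ∈ T, LipschitzOnWith L (Φ ω) S)
    (hsmall : ∀ x ∈ S, ∀ δ : ℝ, 0 ≤ δ →
      μ {ω ∈ T | dist (Φ ω x) y ≤ δ} ≤ C * ENNReal.ofReal δ ^ d) :
    μ {ω ∈ T | ∃ x ∈ S, Φ ω x = y} = 0 := by
  obtain ⟨V, hUV, hV⟩ := exists_countable_cover_lowerMinkowskiDim_lt hU
  have hnull (i : ℕ) : μ {ω ∈ T | ∃ x ∈ S ∩ V i, Φ ω x = y} = 0 :=
    measure_exists_mem_eq_eq_zero_of_lowerMinkowskiDim_lt hd hC (hV i) Set.inter_subset_right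
      (fun ω hω => (hLip ω hω).mono Set.inter_subset_left) fun x hx => hsmall x hx.1
  refine measure_mono_null ?_ (measure_iUnion_null hnull)
  rintro ω ⟨hωT, x, hxS, hx⟩
  obtain ⟨i, hi⟩ := Set.mem_iUnion.1 (hUV (hSU hxS))
  exact Set.mem_iUnion.2 ⟨i, hωT, x, ⟨hxS, hi⟩, hx⟩

end SmallBall

section Submersion

lemma lipschitzOnWith_clm_apply_add {𝕜 E F X : Type*} [NontriviallyNormedField 𝕜]
    [SeminormedAddCommGroup E] [NormedSpace 𝕜 E] [SeminormedAddCommGroup F] [NormedSpace 𝕜 F]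
    [PseudoMetricSpace X] {U : Set X} {Ψ : X → E →L[𝕜] F} {β : X → F} {L L' R : ℝ≥0}
    (hΨ : LipschitzOnWith L Ψ U) (hβ : LipschitzOnWith L' β U) {a : E} (ha : ‖a‖ ≤ R) :
    LipschitzOnWith (L * R + L') (fun x => Ψ x a + β x) U := by
  refine LipschitzOnWith.add (LipschitzOnWith.of_dist_le_mul fun x hx x' hx' => ?_) hβ
  have h := hΨ.dist_le_mul x hx x' hx'
  rw [dist_eq_norm] at h ⊢
  calc ‖Ψ x a - Ψ x' a‖ ≤ ‖Ψ x - Ψ x'‖ * ‖a‖ := (Ψ x - Ψ x').le_opNorm a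
    _ ≤ L * dist x x' * R := by gcongr
    _ = (L * R : ℝ≥0) * dist x x' := by push_cast; ring

/- Integrate the indicator of the set `W` of pairs `(v, a)` with `a + g v ∈ T` and `f (a + g v) ∈ Q`
over `P × E` in both orders: the slices of `W` at fixed `v` are translates of one set, while the
slice at fixed `a` is contained in a translate of `Q`. -/
lemma measure_mul_measure_inter_preimage_le {E F : Type*}
    [AddCommGroup E] [MeasurableSpace E] [MeasurableAdd₂ E]
    [AddCommGroup F] [MeasurableSpace F] [MeasurableAdd F]
    (μ : Measure E) [SFinite μ] [μ.IsAddRightInvariant]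
    (ν : Measure F) [SFinite ν] [ν.IsAddLeftInvariant]
    {f : E → F} {g : F → E} (hf : Measurable f) (hg : Measurable g)
    (hfg : ∀ a v, f (a + g v) = f a + v)
    {T : Set E} (hT : MeasurableSet T) {Q : Set F} (hQ : MeasurableSet Q) (P : Set F) :
    ν P * μ (T ∩ f ⁻¹' Q) ≤ ν Q * μ (T - g '' P) := by
  let W : Set (F × E) := {z | z.2 + g z.1 ∈ T ∩ f ⁻¹' Q}
  have hW : MeasurableSet W :=
    (measurable_snd.add (hg.comp measurable_fst)) (hT.inter (hf hQ))
  have hslice (a : E) : ν.restrict P ((fun v => (v, a)) ⁻¹' W) ≤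
      (T - g '' P).indicator (fun _ => ν Q) a := by
    have hsub : (fun v => (v, a)) ⁻¹' W ⊆ (fun v => f a + v) ⁻¹' Q := fun v hv => by
      simpa only [Set.mem_preimage, hfg] using hv.2
    by_cases ha : a ∈ T - g '' P
    · rw [Set.indicator_of_mem ha, ← measure_preimage_add ν (f a) Q]
      exact (Measure.restrict_apply_le _ _).trans (measure_mono hsub)
    · have hempty : (fun v => (v, a)) ⁻¹' W ∩ P = ∅ := by
        refine Set.eq_empty_of_forall_notMem fun v hv => ha ?_
        exact ⟨a + g v, hv.1.1, g v, Set.mem_image_of_mem g hv.2, add_sub_cancel_right a (g v)⟩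
      rw [Measure.restrict_apply (measurable_prodMk_right hW), hempty, measure_empty]
      exact zero_le
  calc ν P * μ (T ∩ f ⁻¹' Q)
      = ∫⁻ v in P, μ (Prod.mk v ⁻¹' W) ∂ν := by
        have htranslate (v : F) : μ (Prod.mk v ⁻¹' W) = μ (T ∩ f ⁻¹' Q) :=
          measure_preimage_add_right μ (g v) (T ∩ f ⁻¹' Q)
        simp only [htranslate, setLIntegral_const, mul_comm]
    _ = ∫⁻ a, ν.restrict P ((fun v => (v, a)) ⁻¹' W) ∂μ := by
        rw [← Measure.prod_apply hW, Measure.prod_apply_symm hW]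
    _ ≤ ∫⁻ a, (T - g '' P).indicator (fun _ => ν Q) a ∂μ := lintegral_mono hslice
    _ ≤ ν Q * μ (T - g '' P) := lintegral_indicator_const_le _ _

variable {E F : Type*} [NormedAddCommGroup E] [NormedSpace ℝ E] [FiniteDimensional ℝ E]
  [MeasurableSpace E] [BorelSpace E] (μ : Measure E) [μ.IsAddHaarMeasure]
  [NormedAddCommGroup F] [NormedSpace ℝ F] [FiniteDimensional ℝ F]

lemma measure_closedBall_inter_preimage_closedBall_le {f : E →L[ℝ] F} {g : F →L[ℝ] E}
    (hfg : f ∘L g = .id ℝ F) {M : ℝ} (hg : ‖g‖ ≤ M) (R : ℝ) (b : F)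
    {δ : ℝ} (hδ : 0 ≤ δ) :
    μ (closedBall 0 R ∩ f ⁻¹' closedBall b δ) ≤
      μ (closedBall 0 (R + M)) * ENNReal.ofReal δ ^ finrank ℝ F := by
  borelize F
  let ν : Measure F := Measure.addHaar
  have hadd (a : E) (v : F) : f (a + g v) = f a + v := by
    rw [map_add, ← ContinuousLinearMap.comp_apply, hfg, ContinuousLinearMap.id_apply]
  have hthicken : closedBall (0 : E) R - g '' closedBall 0 1 ⊆ closedBall 0 (R + M) := by
    rintro _ ⟨a, ha, _, ⟨v, hv, rfl⟩, rfl⟩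
    rw [mem_closedBall_zero_iff] at *
    calc ‖a - g v‖ ≤ ‖a‖ + ‖g‖ * ‖v‖ := (norm_sub_le _ _).trans (by gcongr; exact g.le_opNorm v)
      _ ≤ R + M * 1 := by gcongr; exact (norm_nonneg g).trans hg
      _ = R + M := by rw [mul_one]
  have hunit : ν (closedBall 0 1) ≠ 0 := (measure_closedBall_pos ν 0 one_pos).ne'
  rw [← ENNReal.mul_le_mul_iff_right hunit measure_closedBall_lt_top.ne]
  calc ν (closedBall 0 1) * μ (closedBall 0 R ∩ f ⁻¹' closedBall b δ)
      ≤ ν (closedBall b δ) * μ (closedBall 0 R - g '' closedBall 0 1) :=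
        measure_mul_measure_inter_preimage_le μ ν f.continuous.measurable g.continuous.measurable
          hadd measurableSet_closedBall measurableSet_closedBall _
    _ ≤ ν (closedBall b δ) * μ (closedBall 0 (R + M)) := by gcongr
    _ = ν (closedBall 0 1) * (μ (closedBall 0 (R + M)) * ENNReal.ofReal δ ^ finrank ℝ F) := by
        rw [Measure.addHaar_closedBall' ν b hδ, ENNReal.ofReal_pow hδ]
        ring

variable {X : Type*} [PseudoMetricSpace X] {U : Set X} {Ψ : X → E →L[ℝ] F} {β : X → F}
  {L L' : ℝ≥0}

lemma measure_closedBall_exists_apply_add_eq_zero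
    (hU : lowerModifiedMinkowskiDim U < (finrank ℝ F : EReal))
    (hΨ : LipschitzOnWith L Ψ U) (hβ : LipschitzOnWith L' β U) (R M : ℝ≥0) :
    μ {a ∈ closedBall 0 (R : ℝ) | ∃ x ∈ {x ∈ U | ∃ g : F →L[ℝ] E, Ψ x ∘L g = .id ℝ F ∧ ‖g‖ ≤ M},
      Ψ x a + β x = 0} = 0 := by
  rw [← EReal.coe_natCast] at hU
  refine measure_exists_mem_eq_eq_zero_of_lowerModifiedMinkowskiDim_lt (Nat.cast_nonneg _)
    (measure_closedBall_lt_top (μ := μ) (x := 0) (r := R + M)).ne hU (Set.sep_subset _ _)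
    (fun a ha => (lipschitzOnWith_clm_apply_add hΨ hβ (mem_closedBall_zero_iff.1 ha)).mono
      (Set.sep_subset _ _)) ?_
  rintro x ⟨-, g, hg, hgM⟩ δ hδ
  have hset : {a ∈ closedBall 0 (R : ℝ) | dist (Ψ x a + β x) 0 ≤ δ} =
      closedBall 0 (R : ℝ) ∩ Ψ x ⁻¹' closedBall (-β x) δ := by
    ext a
    simp [dist_eq_norm]
  rw [hset, ENNReal.rpow_natCast]
  exact measure_closedBall_inter_preimage_closedBall_le μ hg hgM R (-β x) hδ

theorem ae_forall_mem_apply_add_ne_zero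
    (hU : lowerModifiedMinkowskiDim U < (finrank ℝ F : EReal))
    (hΨ : LipschitzOnWith L Ψ U) (hβ : LipschitzOnWith L' β U) :
    ∀ᵐ a ∂μ, ∀ x ∈ U, Function.Surjective (Ψ x) → Ψ x a + β x ≠ 0 := by
  have hnull (R M : ℕ) := measure_closedBall_exists_apply_add_eq_zero μ hU hΨ hβ R M
  simp only [measure_eq_zero_iff_ae_notMem, ← ae_all_iff] at hnull
  filter_upwards [hnull] with a ha x hxU hsurj hzero
  obtain ⟨g, hg⟩ := (Ψ x).exists_rightInverse_of_surjective (LinearMap.range_eq_top.2 hsurj)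
  obtain ⟨R, hR⟩ := exists_nat_ge ‖a‖
  obtain ⟨M, hM⟩ := exists_nat_ge ‖g‖
  exact ha R M ⟨by simpa using hR, x, ⟨hxU, g, hg, by simpa using hM⟩, hzero⟩

end Submersion

section Matrices

lemma surjective_mulVec_of_ne_zero {ι κ 𝕜 : Type*} [Fintype κ] [Field 𝕜]
    {y : κ → 𝕜} (hy : y ≠ 0) : Function.Surjective fun A : Matrix ι κ 𝕜 => A *ᵥ y := by
  classical
  obtain ⟨j, hj⟩ := Function.ne_iff.1 hy
  intro v
  refine ⟨vecMulVec v (Pi.single j (y j)⁻¹), ?_⟩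
  have hone : (y j)⁻¹ * y j = 1 := inv_mul_cancel₀ hj
  simp [vecMulVec_mulVec, single_dotProduct, hone]

theorem ae_forall_mem_mulVec_add_ne_zero {ι κ 𝕜 X : Type*} [Fintype ι] [Fintype κ] [RCLike 𝕜]
    [MeasurableSpace 𝕜] [BorelSpace 𝕜] [PseudoMetricSpace X]
    (μ : Measure (ι → κ → 𝕜)) [μ.IsAddHaarMeasure]
    {U : Set X} (hU : lowerModifiedMinkowskiDim U < (finrank ℝ (ι → 𝕜) : EReal))
    {y : X → κ → 𝕜} {b : X → ι → 𝕜} {L L' : ℝ≥0}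
    (hy : LipschitzOnWith L y U) (hb : LipschitzOnWith L' b U) :
    ∀ᵐ A ∂μ, ∀ x ∈ U, y x ≠ 0 → of A *ᵥ y x + b x ≠ 0 := by
  let mulVecCLM : (κ → 𝕜) →L[ℝ] (ι → κ → 𝕜) →L[ℝ] (ι → 𝕜) :=
    LinearMap.toContinuousBilinearMap (mulVecBilin ℝ ℝ).flip
  filter_upwards [ae_forall_mem_apply_add_ne_zero μ hU (mulVecCLM.lipschitz.comp_lipschitzOnWith hy)
    hb] with A hA x hxU hyx
  exact hA x hxU (surjective_mulVec_of_ne_zero hyx)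

lemma mulVec_injective_of_rank_eq_card {ι κ 𝕜 : Type*} [Fintype κ] [Field 𝕜]
    {B : Matrix ι κ 𝕜} (hB : B.rank = Fintype.card κ) : Function.Injective B.mulVec := by
  rw [mulVec_injective_iff, linearIndependent_iff_card_eq_finrank_span, ← hB,
    rank_eq_finrank_span_cols, Set.finrank]

variable {m p q : ℕ}

lemma hconcat_mulVec (A : Matrix (Fin m) (Fin p) ℂ) (B : Matrix (Fin m) (Fin q) ℂ)
    (x : Fin (p + q) → ℂ) :
    hconcat A B *ᵥ x =
      A *ᵥ (fun k => x (Fin.castAdd q k)) + B *ᵥ (fun k => x (Fin.natAdd p k)) := by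
  ext i
  simp [mulVec, dotProduct, hconcat, Fin.sum_univ_add]

lemma mulVec_natAdd_ne_zero {B : Matrix (Fin m) (Fin q) ℂ} (hB : Function.Injective B.mulVec)
    {x : EuclideanSpace ℂ (Fin (p + q))} (hx : x ≠ 0) (hhead : ∀ k, x (Fin.castAdd q k) = 0) :
    B *ᵥ (fun k => x (Fin.natAdd p k)) ≠ 0 := by
  intro hBx
  have htail := hB (hBx.trans (mulVec_zero B).symm)
  refine hx ?_
  ext l
  exact Fin.addCases hhead (congrFun htail) l

theorem mainTheorem1_general (m p q : ℕ) (U : Set (EuclideanSpace ℂ (Fin (p + q))))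
    (hdim : lowerModifiedMinkowskiDim U < ((2 * m : ℕ) : EReal))
    (B : Matrix (Fin m) (Fin q) ℂ)
    (hB : ∀ x ∈ U \ {0}, (∀ k, x (Fin.castAdd q k) = 0) →
      B *ᵥ (fun k => x (Fin.natAdd p k)) ≠ 0) :
    ∀ᵐ A : Fin m → Fin p → ℂ ∂volume,
      (LinearMap.ker (Matrix.toEuclideanLin (Matrix.hconcat (Matrix.of A) B)) :
        Set (EuclideanSpace ℂ (Fin (p + q)))) ∩ (U \ {0}) = ∅ := by
  let head : EuclideanSpace ℂ (Fin (p + q)) →L[ℝ] (Fin p → ℂ) :=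
    .pi fun k => (EuclideanSpace.proj (𝕜 := ℂ) (Fin.castAdd q k)).restrictScalars ℝ
  let tail : EuclideanSpace ℂ (Fin (p + q)) →L[ℝ] (Fin q → ℂ) :=
    .pi fun k => (EuclideanSpace.proj (𝕜 := ℂ) (Fin.natAdd p k)).restrictScalars ℝ
  let lower : EuclideanSpace ℂ (Fin (p + q)) →L[ℝ] (Fin m → ℂ) :=
    (B.mulVecLin.toContinuousLinearMap.restrictScalars ℝ).comp tail
  have hfinrank : finrank ℝ (Fin m → ℂ) = 2 * m := by
    simp [finrank_pi_fintype, Complex.finrank_real_complex, mul_comm]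
  -- The instance found by unification exceeds the size limit of instance search.
  have : (volume : Measure (Fin m → Fin p → ℂ)).IsAddHaarMeasure := Measure.pi.isAddHaarMeasure _
  have htransverse := ae_forall_mem_mulVec_add_ne_zero volume (by rwa [hfinrank])
    head.lipschitz.lipschitzOnWith lower.lipschitz.lipschitzOnWith
  filter_upwards [htransverse] with A hA
  refine Set.eq_empty_of_forall_notMem ?_
  rintro x ⟨hker, hxU⟩
  have hker' : of A *ᵥ head x + lower x = 0 :=
    (hconcat_mulVec (of A) B x.ofLp).symm.trans
      (congrArg WithLp.ofLp (LinearMap.mem_ker.1 hker))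
  by_cases hhead : head x = 0
  · exact hB x hxU (congrFun hhead) (by rwa [hhead, mulVec_zero, zero_add] at hker')
  · exact hA x hxU.1 hhead hker'

end Matrices

/-- Almost all `A` is with respect to Lebesgue measure on `ℂ^{m × p}`, i.e. the product `volume` on
`Fin m → Fin p → ℂ`. -/
theorem mainTheorem1 (m p q : ℕ) (U : Set (EuclideanSpace ℂ (Fin (p + q)))) (hU : U.Nonempty)
    (hdim : lowerModifiedMinkowskiDim U < ((2 * m : ℕ) : EReal))
    (B : Matrix (Fin m) (Fin q) ℂ) (hmq : q ≤ m) (hB : B.rank = min m q) :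
    ∀ᵐ A : Fin m → Fin p → ℂ ∂volume,
      (LinearMap.ker (Matrix.toEuclideanLin (Matrix.hconcat (Matrix.of A) B)) :
        Set (EuclideanSpace ℂ (Fin (p + q)))) ∩ (U \ {0}) = ∅ := by
  have hBinj : Function.Injective B.mulVec :=
    mulVec_injective_of_rank_eq_card (by rw [hB, min_eq_right hmq, Fintype.card_fin])
  exact mainTheorem1_general m p q U hdim B fun x hx => mulVec_natAdd_ne_zero hBinj hx.2
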